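/- Fix a positive integer $n$ and put $I=\mathbb{Z}/n\mathbb{Z}$. Let $V=\bigoplus_{i\in I}V_i$ be a finite-dimensional $I$-graded complex vector space, let $E_V=\bigoplus_{i\in I}\mathrm{Hom}(V_i,V_{i-1})$ be the space of representations on $V$ of the cyclic quiver with vertex set $I$ and arrows $i\to i-1$, and let $G_V=\prod_{i\in I}GL(V_i)$ act on $E_V$ by conjugation. For $i\in I$ and $l\ge 0$ let $[i;l)$ denote the representation with basis $e_0,\dots,e_{l-1}$, where $e_k$ has degree $i+k$ and $e_k\mapsto e_{k-1}$ for $k\ge 1$, $e_0\mapsto 0$ (so $[i;0)=0$, and for $l\ge 1$ this is the nilpotent indecomposable of length $l$ with socle at $i$). For $\boldsymbol\lambda=[i_1;l_1)\oplus[i_2;l_2)$ with the same dimension vector as $V$, let $\mathcal{O}_{\boldsymbol\lambda}\subseteq E_V$ be the $G_V$-orbit of the points isomorphic to $\boldsymbol\lambda$, and write $\boldsymbol\mu\le\boldsymbol\lambda$ if $\boldsymbol\mu$ also has the dimension vector of $V$ and $\mathcal{O}_{\boldsymbol\mu}\subseteq\overline{\mathcal{O}_{\boldsymbol\lambda}}$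 (Zariski closure in $E_V$). For $c\in\mathbb{Z}/n\mathbb{Z}$ let $\{c\}$ be its representative in $\{0,1,\dots,n-1\}$. Let $i_1,i_2\in I$, let $l_1\ge l_2\ge 0$ and $m_1,m_2\ge 0$ be integers, let $V$ have the dimension vector of $\boldsymbol\lambda=[i_1;l_1)\oplus[i_2;l_2)$, and let $\boldsymbol\mu=[i_1;m_1)\oplus[i_2;m_2)$. Then $\boldsymbol\mu\le\boldsymbol\lambda$ if and only if either $(m_1,m_2)=(l_1,l_2)$, or \[ m_1+m_2=l_1+l_2,\qquad l_1\ge m_1\ge l_2+\{i_2-i_1\}, \] and at least one of the following holds: (a) $m_1\equiv l_1$ and $m_2\equiv l_2 \pmod n$; (b) $m_1\equiv i_2-i_1+l_2$ and $m_2\equiv i_1-i_2+l_1 \pmod n$. -/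

import Mathlib

noncomputable section

/-- The representation space `E_V = ⨁ i, Hom (V i, V (i - 1))` of the cyclic quiver with vertex
set `ℤ/n` and one arrow `i → i - 1` for every `i`. -/
abbrev CyclicRep {n : ℕ} (V : ZMod n → Type*) [∀ i, AddCommGroup (V i)]
    [∀ i, Module ℂ (V i)] : Type _ :=
  ∀ i, V i →ₗ[ℂ] V (i - 1)

/-- Isomorphism of representations. For `W = V` this says that the two points of `E_V` lie in one
orbit of `G_V = ∏ i, GL (V i)` acting by conjugation. -/
def CyclicRep.IsIso {n : ℕ} {V W : ZMod n → Type*}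
    [∀ i, AddCommGroup (V i)] [∀ i, Module ℂ (V i)]
    [∀ i, AddCommGroup (W i)] [∀ i, Module ℂ (W i)]
    (x : CyclicRep V) (y : CyclicRep W) : Prop :=
  ∃ g : ∀ i, V i ≃ₗ[ℂ] W i, ∀ i v, g (i - 1) (x i v) = y i (g i v)

/-- The direct sum of two representations. -/
def CyclicRep.directSum {n : ℕ} {V W : ZMod n → Type*}
    [∀ i, AddCommGroup (V i)] [∀ i, Module ℂ (V i)]
    [∀ i, AddCommGroup (W i)] [∀ i, Module ℂ (W i)]
    (x : CyclicRep V) (y : CyclicRep W) : CyclicRep (fun i => V i × W i) :=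
  fun i => (x i).prodMap (y i)

/-- A segment `[i; l)`; `l = 0` gives the empty segment. -/
structure Segment (n : ℕ) where
  /-- the label `i` of the socle -/
  start : ZMod n
  /-- the length `l` -/
  length : ℕ

/-- The boxes `k = 0, …, l - 1` of `[i; l)` whose label `i + k` is `j`. -/
abbrev Segment.Box {n : ℕ} (s : Segment n) (j : ZMod n) : Type :=
  {k : Fin s.length // s.start + ((k : ℕ) : ZMod n) = j}

/-- The indecomposable nilpotent representation `[i; l)`. It has basis vectors
`e 0, …, e (l - 1)`, with `e k` in degree `i + k`, and `e k ↦ e (k - 1)`, `e 0 ↦ 0`.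
In terms of coordinates, the coordinate of the image at `k` is the coordinate at `k + 1`. -/
def Segment.rep {n : ℕ} (s : Segment n) : CyclicRep (fun j => s.Box j → ℂ) :=
  fun j =>
    { toFun := fun f k =>
        if h : (k.1 : ℕ) + 1 < s.length then
          f ⟨⟨(k.1 : ℕ) + 1, h⟩, by
            have hk := k.2
            push_cast
            rw [← add_assoc, hk, sub_add_cancel]⟩
        else 0
      map_add' := by
        intro f g
        funext k
        by_cases h : (k.1 : ℕ) + 1 < s.length <;> simp [h]
      map_smul' := by
        intro c f
        funext k
        by_cases h : (k.1 : ℕ) + 1 < s.length <;> simp [h] }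

/-- A multisegment `[i₁; l₁) ⊕ [i₂; l₂)` with at most two rows. -/
structure TwoRow (n : ℕ) where
  /-- the first row -/
  row₁ : Segment n
  /-- the second row -/
  row₂ : Segment n

/-- The dimension vector `d(λ)`: the number of boxes labelled `j`. -/
def TwoRow.dimVec {n : ℕ} (lam : TwoRow n) (j : ZMod n) : ℕ :=
  Nat.card (lam.row₁.Box j) + Nat.card (lam.row₂.Box j)

/-- The orbit `O_λ` in `E_V`: all points of `E_V` that are isomorphic, as representations, to the
direct sum of the indecomposables given by the rows of `λ`. -/
def TwoRow.orbit {n : ℕ} (lam : TwoRow n) (V : ZMod n → Type*) [∀ i, AddCommGroup (V i)]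
    [∀ i, Module ℂ (V i)] : Set (CyclicRep V) :=
  {x | CyclicRep.IsIso x (CyclicRep.directSum lam.row₁.rep lam.row₂.rep)}

/-- The algebra of polynomial functions on a complex vector space, generated by the
linear functionals. -/
def polyFunctions (E : Type*) [AddCommGroup E] [Module ℂ E] : Subalgebra ℂ (E → ℂ) :=
  Algebra.adjoin ℂ (Set.range fun (φ : Module.Dual ℂ E) (x : E) => φ x)

/-- The Zariski closure of a subset of a complex vector space: the common zeros of all polynomial
functions that vanish on the subset. -/
def zariskiClosure {E : Type*} [AddCommGroup E] [Module ℂ E] (S : Set E) : Set E :=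
  {x | ∀ f ∈ polyFunctions E, (∀ y ∈ S, f y = 0) → f x = 0}

/-- For a graded vector space `V` with dimension vector `d`: `μ ∈ Λ(d)` and `O_μ` is contained
in the closure of `O_λ`. -/
def TwoRow.LEIn {n : ℕ} (V : ZMod n → Type*) [∀ i, AddCommGroup (V i)]
    [∀ i, Module ℂ (V i)] (mu lam : TwoRow n) : Prop :=
  (∀ j, mu.dimVec j = Module.finrank ℂ (V j)) ∧
    mu.orbit V ⊆ zariskiClosure (lam.orbit V)

end

/-! Necessity. Passing from label `j - 1` to `j`, a dimension vector changes by the number of rows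
starting at `j` minus the number of rows ending just before `j`. The starts of both multisegments
agree, so the end labels agree up to order; this gives the congruences, and summing over labels
gives `m₁ + m₂ = l₁ + l₂`. The rank of the path of length `k` from `j` is the number of boxes `p ≥
k` labelled `j`, and it cannot increase in the closure (`TwoRow.boxCount_le_of_mem_zariskiClosure`).
Taking `k = l₁` bounds both `m₁` and `m₂` by `l₁`. In case (a) one further path, `k = m₁ + 1`, gives
the lower bound on `m₁`; in case (b) it follows from `l₂ ≤ m₁` and the congruence.

Sufficiency. If `e ≡ i₂ - i₁` and `l ≤ m`, an explicit line of representations shows that `[i₁; m +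
e) ⊕ [i₂; l)` degenerates to `[i₁; l + e) ⊕ [i₂; m)`
(`TwoRow.orbit_subset_zariskiClosure_exchange`). Case (b) is one such exchange. Case (a) is trivial
or a composite of two. -/

open Finset

/-! ### Counting boxes by label. -/

/-- The number of boxes `k ≤ p < l` with label `i + p = j`. -/
def boxCount {n : ℕ} (i : ZMod n) (k l : ℕ) (j : ZMod n) : ℕ :=
  ((Ico k l).filter fun p : ℕ => i + (p : ZMod n) = j).card

theorem boxCount_add {n : ℕ} (i j : ZMod n) {k m l : ℕ} (h₁ : k ≤ m) (h₂ : m ≤ l) :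
    boxCount i k l j = boxCount i k m j + boxCount i m l j := by
  unfold boxCount
  rw [← Ico_union_Ico_eq_Ico h₁ h₂, filter_union, card_union_of_disjoint]
  exact disjoint_filter_filter (Ico_disjoint_Ico_consecutive k m l)

theorem boxCount_shift {n : ℕ} (i j : ZMod n) (k l c : ℕ) :
    boxCount i (k + c) (l + c) j = boxCount (i + (c : ZMod n)) k l j := by
  unfold boxCount
  rw [← Finset.image_add_right_Ico k l c, Finset.filter_image,
    Finset.card_image_of_injective _ (add_left_injective c)]
  congr 1
  ext p
  simp only [mem_filter, Nat.cast_add]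
  rw [add_assoc i, add_comm (c : ZMod n)]

theorem boxCount_mono {n : ℕ} (i j : ZMod n) (k : ℕ) {l l' : ℕ} (h : l ≤ l') :
    boxCount i k l j ≤ boxCount i k l' j :=
  card_le_card (filter_subset_filter _ (Ico_subset_Ico_right h))

theorem boxCount_of_le {n : ℕ} (i j : ZMod n) {k l : ℕ} (h : l ≤ k) : boxCount i k l j = 0 := by
  simp [boxCount, Ico_eq_empty_of_le h]

theorem boxCount_succ {n : ℕ} (i j : ZMod n) (k : ℕ) :
    boxCount i k (k + 1) j = if i + (k : ZMod n) = j then 1 else 0 := by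
  unfold boxCount
  rw [Nat.Ico_succ_singleton, filter_singleton]
  split_ifs <;> simp

theorem boxCount_pos {n : ℕ} (i : ZMod n) {k p l : ℕ} (h₁ : k ≤ p) (h₂ : p < l) :
    0 < boxCount i k l (i + p) :=
  card_pos.2 ⟨p, by simp [h₁, h₂]⟩

theorem boxCount_eq_zero {n : ℕ} (i : ZMod n) {d : ℕ} (hd : d < n) :
    boxCount (i + 1) 0 d i = 0 := by
  unfold boxCount
  rw [card_eq_zero, filter_eq_empty_iff]
  intro p hp h
  have hp' := (mem_Ico.1 hp).2
  have h1 : ((p + 1 : ℕ) : ZMod n) = 0 := by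
    push_cast
    linear_combination h
  rw [ZMod.natCast_eq_zero_iff] at h1
  have := Nat.le_of_dvd (Nat.succ_pos p) h1
  omega

theorem boxCount_period {n : ℕ} [NeZero n] (i j : ZMod n) : boxCount i 0 n j = 1 := by
  unfold boxCount
  rw [card_eq_one]
  refine ⟨(j - i).val, ?_⟩
  ext p
  simp only [mem_filter, mem_Ico, mem_singleton, zero_le, true_and]
  constructor
  · rintro ⟨hp, rfl⟩
    rw [add_sub_cancel_left, ZMod.val_natCast_of_lt hp]
  · rintro rfl
    exact ⟨ZMod.val_lt _, by simp⟩

theorem boxCount_mul_period {n : ℕ} [NeZero n] (i j : ZMod n) (t : ℕ) :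
    boxCount i 0 (t * n) j = t := by
  induction t with
  | zero => simp [boxCount]
  | succ t ih =>
    have h := boxCount_shift i j 0 n (t * n)
    rw [boxCount_period, zero_add] at h
    rw [boxCount_add i j (Nat.zero_le (t * n)) (by rw [Nat.succ_mul]; omega), ih, Nat.succ_mul,
      add_comm (t * n) n, h]

theorem Segment.card_box {n : ℕ} (s : Segment n) (j : ZMod n) :
    Nat.card (s.Box j) = boxCount s.start 0 s.length j := by
  unfold boxCount
  rw [Nat.card_eq_fintype_card, Fintype.card_subtype]
  rw [← Finset.card_map Fin.valEmbedding]
  congr 1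
  ext p
  simp only [mem_map, mem_filter, mem_univ, true_and, Fin.valEmbedding_apply, mem_Ico, zero_le]
  constructor
  · rintro ⟨q, hq, rfl⟩
    exact ⟨q.2, hq⟩
  · rintro ⟨hp, h⟩
    exact ⟨⟨p, hp⟩, h, rfl⟩

theorem TwoRow.dimVec_mk {n : ℕ} (i₁ i₂ : ZMod n) (l₁ l₂ : ℕ) (j : ZMod n) :
    (TwoRow.mk ⟨i₁, l₁⟩ ⟨i₂, l₂⟩).dimVec j = boxCount i₁ 0 l₁ j + boxCount i₂ 0 l₂ j := by
  rw [TwoRow.dimVec, Segment.card_box, Segment.card_box]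

/-- Shifting the row by one box moves label `j - 1` to `j`, so the two counts differ only at the two
ends of the row. -/
theorem boxCount_sub_one {n : ℕ} (i j : ZMod n) (l : ℕ) :
    boxCount i 0 l j + (if i + (l : ZMod n) = j then 1 else 0) =
      boxCount i 0 l (j - 1) + (if i = j then 1 else 0) := by
  have h1 := boxCount_add i j (Nat.zero_le l) (Nat.le_succ l)
  have h2 := boxCount_add i j (Nat.zero_le 1) (Nat.succ_le_succ (Nat.zero_le l))
  have h3 : boxCount i 1 (l + 1) j = boxCount i 0 l (j - 1) := by
    have := boxCount_shift i j 0 l 1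
    rw [zero_add] at this
    rw [this]
    unfold boxCount
    congr 1
    ext p
    simp only [mem_filter, and_congr_right_iff, Nat.cast_one]
    intro _
    constructor <;> intro h <;> linear_combination h
  have h4 := boxCount_succ i j 0
  have h5 := boxCount_succ i j l
  simp only [Nat.cast_zero, add_zero, zero_add, Nat.succ_eq_add_one] at *
  omega

theorem sum_boxCount {n : ℕ} [NeZero n] (i : ZMod n) (k l : ℕ) :
    ∑ j, boxCount i k l j = l - k := by
  unfold boxCount
  rw [← Nat.card_Ico k l]
  exact (card_eq_sum_card_fiberwise (fun _ _ => mem_coe.2 (mem_univ _))).symm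

/-! ### Constraints from the dimension vector. -/

theorem TwoRow.length_add_of_dimVec_eq {n : ℕ} [NeZero n] {i₁ i₂ : ZMod n} {l₁ l₂ m₁ m₂ : ℕ}
    (h : ∀ j, (TwoRow.mk ⟨i₁, m₁⟩ ⟨i₂, m₂⟩).dimVec j =
      (TwoRow.mk ⟨i₁, l₁⟩ ⟨i₂, l₂⟩).dimVec j) : m₁ + m₂ = l₁ + l₂ := by
  have := Finset.sum_congr (rfl : (univ : Finset (ZMod n)) = univ) fun j _ => h j
  simpa [TwoRow.dimVec_mk, sum_add_distrib, sum_boxCount] using this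

theorem TwoRow.length_congr_of_dimVec_eq {n : ℕ} [NeZero n] {i₁ i₂ : ZMod n} {l₁ l₂ m₁ m₂ : ℕ}
    (h : ∀ j, (TwoRow.mk ⟨i₁, m₁⟩ ⟨i₂, m₂⟩).dimVec j =
      (TwoRow.mk ⟨i₁, l₁⟩ ⟨i₂, l₂⟩).dimVec j) :
    ((m₁ : ZMod n) = (l₁ : ZMod n) ∧ (m₂ : ZMod n) = (l₂ : ZMod n)) ∨
      ((m₁ : ZMod n) = i₂ - i₁ + (l₂ : ZMod n) ∧
        (m₂ : ZMod n) = i₁ - i₂ + (l₁ : ZMod n)) := by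
  have hs : (m₁ : ZMod n) + m₂ = l₁ + l₂ := by
    exact_mod_cast congrArg (Nat.cast : ℕ → ZMod n) (TwoRow.length_add_of_dimVec_eq h)
  -- Otherwise `boxCount_sub_one` at the label `i₁ + m₁` sees a row end on the `m` side and none on
  -- the `l` side.
  have key : i₁ + (l₁ : ZMod n) = i₁ + m₁ ∨ i₂ + (l₂ : ZMod n) = i₁ + m₁ := by
    by_contra! hc
    have h1 := boxCount_sub_one i₁ (i₁ + m₁) m₁
    have h2 := boxCount_sub_one i₂ (i₁ + m₁) m₂
    have h3 := boxCount_sub_one i₁ (i₁ + m₁) l₁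
    have h4 := boxCount_sub_one i₂ (i₁ + m₁) l₂
    have h5 := h (i₁ + m₁)
    have h6 := h (i₁ + m₁ - 1)
    rw [TwoRow.dimVec_mk, TwoRow.dimVec_mk] at h5 h6
    rw [if_pos rfl] at h1
    rw [if_neg hc.1] at h3
    rw [if_neg hc.2] at h4
    omega
  rcases key with hk | hk
  · left
    have : (m₁ : ZMod n) = l₁ := by linear_combination -hk
    exact ⟨this, by linear_combination hs - this⟩
  · right
    have : (m₁ : ZMod n) = i₂ - i₁ + l₂ := by linear_combination -hk
    exact ⟨this, by linear_combination hs - this⟩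

/-- Exchanging the parts of two overlapping rows above the overlap keeps the dimension vector. -/
theorem TwoRow.dimVec_exchange {n : ℕ} (i₁ i₂ : ZMod n) (e l m : ℕ)
    (he : (e : ZMod n) = i₂ - i₁) (j : ZMod n) :
    (TwoRow.mk ⟨i₁, l + e⟩ ⟨i₂, m⟩).dimVec j = (TwoRow.mk ⟨i₁, m + e⟩ ⟨i₂, l⟩).dimVec j := by
  -- From box `e` on, the first row carries the same labels as a row starting at `i₂`.
  have h (a : ℕ) : boxCount i₁ 0 (a + e) j = boxCount i₁ 0 e j + boxCount i₂ 0 a j := by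
    have := boxCount_shift i₁ j 0 a e
    rw [zero_add, he, add_sub_cancel] at this
    rw [boxCount_add i₁ j (Nat.zero_le e) (Nat.le_add_left e a), this]
  rw [TwoRow.dimVec_mk, TwoRow.dimVec_mk, h, h]
  omega

/-! ### Segments in sequence coordinates. -/

namespace Segment

/-- Extension by zero: the coordinate of `f` at an arbitrary natural number. -/
def extend {n : ℕ} (s : Segment n) (j : ZMod n) : (s.Box j → ℂ) →ₗ[ℂ] (ℕ → ℂ) where
  toFun f p := if h : p < s.length ∧ s.start + (p : ZMod n) = j then f ⟨⟨p, h.1⟩, h.2⟩ else 0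
  map_add' f g := by
    funext p
    by_cases h : p < s.length ∧ s.start + (p : ZMod n) = j <;> simp [h]
  map_smul' c f := by
    funext p
    by_cases h : p < s.length ∧ s.start + (p : ZMod n) = j <;> simp [h]

/-- Restriction of a sequence to the boxes labelled `j`. -/
def restrict {n : ℕ} (s : Segment n) (j : ZMod n) : (ℕ → ℂ) →ₗ[ℂ] (s.Box j → ℂ) :=
  LinearMap.funLeft ℂ ℂ fun b => (b.1 : ℕ)

variable {n : ℕ} (s : Segment n) (j : ZMod n)

theorem restrict_apply (a : ℕ → ℂ) (b : s.Box j) : s.restrict j a b = a b.1 := rfl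

theorem extend_apply_box (f : s.Box j → ℂ) (b : s.Box j) : s.extend j f b.1 = f b :=
  dif_pos ⟨b.1.2, b.2⟩

theorem extend_eq_zero (f : s.Box j → ℂ) {p : ℕ}
    (h : ¬ (p < s.length ∧ s.start + (p : ZMod n) = j)) : s.extend j f p = 0 :=
  dif_neg h

theorem extend_eq_zero_of_le (f : s.Box j → ℂ) {p : ℕ} (h : s.length ≤ p) :
    s.extend j f p = 0 :=
  s.extend_eq_zero j f fun h' => absurd h'.1 h.not_gt

theorem restrict_extend (f : s.Box j → ℂ) : s.restrict j (s.extend j f) = f :=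
  funext fun b => s.extend_apply_box j f b

theorem extend_restrict (a : ℕ → ℂ) (p : ℕ) :
    s.extend j (s.restrict j a) p = if p < s.length ∧ s.start + (p : ZMod n) = j then a p else 0 := by
  split_ifs with h
  · exact s.extend_apply_box j _ ⟨⟨p, h.1⟩, h.2⟩
  · exact s.extend_eq_zero j _ h

theorem extend_restrict_of_mem (a : ℕ → ℂ) {p : ℕ} (h₁ : p < s.length)
    (h₂ : s.start + (p : ZMod n) = j) : s.extend j (s.restrict j a) p = a p := by
  rw [extend_restrict, if_pos ⟨h₁, h₂⟩]

theorem rep_apply (f : s.Box j → ℂ) (b : s.Box (j - 1)) :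
    s.rep j f b = s.extend j f (b.1 + 1) := by
  have hb : s.start + ((b.1 : ℕ) + 1 : ℕ) = j := by
    have := b.2
    push_cast
    rw [← add_assoc, this, sub_add_cancel]
  by_cases h : (b.1 : ℕ) + 1 < s.length
  · exact (dif_pos h).trans (dif_pos ⟨h, hb⟩ : s.extend j f (b.1 + 1) = _).symm
  · rw [s.extend_eq_zero j f fun h' => h h'.1]
    exact dif_neg h

/-- On sequences indexed by `ℕ` every arrow is the left shift: the label condition at `p` for `j -
1` is the one at `p + 1` for `j`, and the zero past the end replaces the case distinction in `rep`.
-/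
theorem extend_rep (f : s.Box j → ℂ) (p : ℕ) :
    s.extend (j - 1) (s.rep j f) p = s.extend j f (p + 1) := by
  by_cases h : p < s.length ∧ s.start + (p : ZMod n) = j - 1
  · exact (s.extend_apply_box (j - 1) _ ⟨⟨p, h.1⟩, h.2⟩).trans (s.rep_apply j f _)
  · rw [s.extend_eq_zero _ _ h, s.extend_eq_zero]
    rintro ⟨h₁, h₂⟩
    refine h ⟨by omega, ?_⟩
    push_cast at h₂
    linear_combination h₂

end Segment

/-! ### Paths in the cyclic quiver. -/

namespace CyclicRep

/-- The vertex reached from `j` after `k` arrows. -/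
def target {n : ℕ} : ℕ → ZMod n → ZMod n
  | 0, j => j
  -- This recursion matches that of `iter`, so no transport between fibres of `V` is needed.
  | k + 1, j => target k (j - 1)

/-- The action of the path of length `k` that starts at `j`. -/
def iter {n : ℕ} {V : ZMod n → Type*} [∀ i, AddCommGroup (V i)] [∀ i, Module ℂ (V i)]
    (x : CyclicRep V) : ∀ (k : ℕ) (j : ZMod n), V j →ₗ[ℂ] V (target k j)
  | 0, _ => LinearMap.id
  | k + 1, j => iter x k (j - 1) ∘ₗ x j

section

variable {n : ℕ} {V W : ZMod n → Type*} [∀ i, AddCommGroup (V i)] [∀ i, Module ℂ (V i)]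
  [∀ i, AddCommGroup (W i)] [∀ i, Module ℂ (W i)]

theorem iter_succ_apply (x : CyclicRep V) (k : ℕ) (j : ZMod n) (v : V j) :
    x.iter (k + 1) j v = x.iter k (j - 1) (x j v) := rfl

theorem map_iter {x : CyclicRep V} {y : CyclicRep W} (g : ∀ i, V i ≃ₗ[ℂ] W i)
    (hg : ∀ i v, g (i - 1) (x i v) = y i (g i v)) (k : ℕ) (j : ZMod n) (v : V j) :
    g (target k j) (x.iter k j v) = y.iter k j (g j v) := by
  induction k generalizing j with
  | zero => rfl
  | succ k ih => rw [iter_succ_apply, iter_succ_apply, ← hg, ← ih]; rfl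

theorem directSum_iter (x : CyclicRep V) (y : CyclicRep W) (k : ℕ) (j : ZMod n) (v : V j × W j) :
    (x.directSum y).iter k j v = (x.iter k j v.1, y.iter k j v.2) := by
  induction k generalizing j with
  | zero => rfl
  | succ k ih => rw [iter_succ_apply, ih]; rfl

theorem extend_iter_rep (s : Segment n) (k : ℕ) (j : ZMod n) (f : s.Box j → ℂ) (p : ℕ) :
    s.extend (target k j) (iter s.rep k j f) p = s.extend j f (p + k) := by
  induction k generalizing j with
  | zero => rfl
  | succ k ih =>
    rw [iter_succ_apply]
    refine (ih (j - 1) _).trans ?_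
    rw [s.extend_rep]
    rfl

end

end CyclicRep

/-! ### Semicontinuity of path ranks. -/

theorem polyFunctions_iter {n : ℕ} {V : ZMod n → Type*} [∀ i, AddCommGroup (V i)]
    [∀ i, Module ℂ (V i)] [∀ i, FiniteDimensional ℂ (V i)] (k : ℕ) (j : ZMod n) (v : V j)
    (ξ : Module.Dual ℂ (V (CyclicRep.target k j))) :
    (fun x : CyclicRep V => ξ (x.iter k j v)) ∈ polyFunctions (CyclicRep V) := by
  induction k generalizing j with
  | zero => exact (polyFunctions (CyclicRep V)).algebraMap_mem (ξ v)
  | succ k ih =>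
    let b := Module.finBasis ℂ (V (j - 1))
    have h : (fun x : CyclicRep V => ξ (x.iter (k + 1) j v)) =
        ∑ a, (fun x : CyclicRep V => b.coord a (x j v)) *
          (fun x : CyclicRep V => ξ (x.iter k (j - 1) (b a))) := by
      funext x
      let η : Module.Dual ℂ (V (CyclicRep.target k (j - 1))) := ξ
      change (η ∘ₗ x.iter k (j - 1)) (x j v) = _
      conv_lhs => rw [← b.sum_repr (x j v), map_sum]
      simp only [Finset.sum_apply, Pi.mul_apply, map_smul, smul_eq_mul, Module.Basis.coord_apply]
      rfl
    rw [h]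
    refine sum_mem fun a _ => mul_mem (Algebra.subset_adjoin ?_) (ih (j - 1) (b a) ξ)
    exact ⟨b.coord a ∘ₗ LinearMap.applyₗ v ∘ₗ LinearMap.proj j, rfl⟩

theorem polyFunctions_det {E ι : Type*} [AddCommGroup E] [Module ℂ E] [Fintype ι] [DecidableEq ι]
    (M : E → Matrix ι ι ℂ) (hM : ∀ a b, (fun x => M x a b) ∈ polyFunctions E) :
    (fun x => (M x).det) ∈ polyFunctions E := by
  have h : (fun x => (M x).det) =
      ∑ σ : Equiv.Perm ι, Equiv.Perm.sign σ • ∏ a, fun x => M x (σ a) a := by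
    funext x
    simp [Matrix.det_apply, Finset.sum_apply, Finset.prod_apply]
  rw [h]
  refine sum_mem fun σ _ => ?_
  rw [Units.smul_def]
  exact zsmul_mem (prod_mem fun a _ => hM _ _) _

/-- Lower semicontinuity of the rank of a path. -/
theorem exists_injective_of_mem_zariskiClosure {n : ℕ} {V : ZMod n → Type*}
    [∀ i, AddCommGroup (V i)] [∀ i, Module ℂ (V i)] [∀ i, FiniteDimensional ℂ (V i)]
    {S : Set (CyclicRep V)} {x : CyclicRep V} (hx : x ∈ zariskiClosure S) {ι : Type*} [Fintype ι]
    [DecidableEq ι] (k : ℕ) (j : ZMod n) (v : ι → V j)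
    (ξ : ι → Module.Dual ℂ (V (CyclicRep.target k j)))
    (h : ∀ a b, ξ a (x.iter k j (v b)) = if a = b then 1 else 0) :
    ∃ y ∈ S, ∀ z : ι → ℂ, y.iter k j (∑ b, z b • v b) = 0 → z = 0 := by
  by_contra! hc
  -- The determinant of this matrix is a polynomial function. A kernel vector at every point of `S`
  -- makes it vanish on `S`, hence at `x`, where the matrix is the identity.
  let M : CyclicRep V → Matrix ι ι ℂ := fun y => Matrix.of fun a b => ξ a (y.iter k j (v b))
  have hM := hx _ (polyFunctions_det M fun a b => polyFunctions_iter k j (v b) (ξ a)) (by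
    intro y hy
    obtain ⟨z, hz, hz0⟩ := hc y hy
    refine Matrix.exists_mulVec_eq_zero_iff.1 ⟨z, hz0, ?_⟩
    funext a
    have := congrArg (ξ a) hz
    rw [map_sum, map_sum, map_zero] at this
    simpa [M, Matrix.mulVec, dotProduct, mul_comm] using this)
  have h1 : M x = 1 := by
    ext a b
    rw [Matrix.one_apply]
    exact h a b
  simp only [h1, Matrix.det_one, one_ne_zero] at hM

namespace Segment

variable {n : ℕ} (s : Segment n)

/-- The indices `p ≥ k` of the boxes labelled `j`. -/
def boxesFrom (k : ℕ) (j : ZMod n) : Finset ℕ :=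
  (Ico k s.length).filter fun p : ℕ => s.start + (p : ZMod n) = j

theorem mem_boxesFrom {k : ℕ} {j : ZMod n} {p : ℕ} :
    p ∈ s.boxesFrom k j ↔ (k ≤ p ∧ p < s.length) ∧ s.start + (p : ZMod n) = j := by
  rw [boxesFrom, mem_filter, mem_Ico]

theorem extend_injective (j : ZMod n) : Function.Injective (s.extend j) :=
  Function.LeftInverse.injective (g := s.restrict j) (s.restrict_extend j)

theorem iter_rep_eq_zero (k : ℕ) (j : ZMod n) (f : s.Box j → ℂ)
    (h : ∀ p ∈ s.boxesFrom k j, s.extend j f p = 0) : CyclicRep.iter s.rep k j f = 0 := by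
  apply s.extend_injective
  rw [map_zero]
  funext p
  rw [CyclicRep.extend_iter_rep]
  by_cases hp : p + k < s.length ∧ s.start + ((p + k : ℕ) : ZMod n) = j
  · exact h _ (s.mem_boxesFrom.2 ⟨⟨by omega, hp.1⟩, hp.2⟩)
  · exact s.extend_eq_zero j f hp

theorem extend_iter_rep_single (k : ℕ) (j : ZMod n) (p q : s.boxesFrom k j) :
    s.extend _ (CyclicRep.iter s.rep k j (s.restrict j (Pi.single (q : ℕ) 1))) (p - k) =
      if p = q then 1 else 0 := by
  have hp := s.mem_boxesFrom.1 p.2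
  rw [CyclicRep.extend_iter_rep, Nat.sub_add_cancel hp.1.1,
    s.extend_restrict_of_mem j _ hp.1.2 hp.2, Pi.single_apply]
  simp only [Subtype.ext_iff]

end Segment

/-- The rank of every path is lower semicontinuous, expressed through box numbers. -/
theorem TwoRow.boxCount_le_of_mem_zariskiClosure {n : ℕ} {V : ZMod n → Type*}
    [∀ i, AddCommGroup (V i)] [∀ i, Module ℂ (V i)] [∀ i, FiniteDimensional ℂ (V i)]
    {mu lam : TwoRow n} {x : CyclicRep V} (hmu : x ∈ mu.orbit V)
    (hlam : x ∈ zariskiClosure (lam.orbit V)) (k : ℕ) (j : ZMod n) :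
    boxCount mu.row₁.start k mu.row₁.length j + boxCount mu.row₂.start k mu.row₂.length j ≤
      boxCount lam.row₁.start k lam.row₁.length j +
        boxCount lam.row₂.start k lam.row₂.length j := by
  obtain ⟨g, hg⟩ := hmu
  -- Basis vectors at the boxes `p ≥ k`; `ξ` reads off position `p - k`, where `k` arrows send them.
  let v : mu.row₁.boxesFrom k j ⊕ mu.row₂.boxesFrom k j → V j := Sum.elim
    (fun p => (g j).symm (mu.row₁.restrict j (Pi.single (p : ℕ) 1), 0))
    (fun p => (g j).symm (0, mu.row₂.restrict j (Pi.single (p : ℕ) 1)))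
  let ξ : mu.row₁.boxesFrom k j ⊕ mu.row₂.boxesFrom k j →
      Module.Dual ℂ (V (CyclicRep.target k j)) := Sum.elim
    (fun p => LinearMap.proj ((p : ℕ) - k) ∘ₗ mu.row₁.extend _ ∘ₗ LinearMap.fst ℂ _ _ ∘ₗ
      (g (CyclicRep.target k j)).toLinearMap)
    (fun p => LinearMap.proj ((p : ℕ) - k) ∘ₗ mu.row₂.extend _ ∘ₗ LinearMap.snd ℂ _ _ ∘ₗ
      (g (CyclicRep.target k j)).toLinearMap)
  have hvξ : ∀ a b, ξ a (x.iter k j (v b)) = if a = b then 1 else 0 := by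
    rintro (p | p) (q | q) <;>
      simp [v, ξ, CyclicRep.map_iter g hg, CyclicRep.directSum_iter,
        Segment.extend_iter_rep_single]
  obtain ⟨y, ⟨h, hh⟩, hy⟩ := exists_injective_of_mem_zariskiClosure hlam k j v ξ hvξ
  -- Only coordinates at boxes `p ≥ k` of `lam` survive `k` arrows, so `Φ` inherits injectivity from
  -- the path map.
  let Φ : (mu.row₁.boxesFrom k j ⊕ mu.row₂.boxesFrom k j → ℂ) →ₗ[ℂ]
      (lam.row₁.boxesFrom k j → ℂ) × (lam.row₂.boxesFrom k j → ℂ) :=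
    ((LinearMap.funLeft ℂ ℂ Subtype.val ∘ₗ lam.row₁.extend j).prodMap
      (LinearMap.funLeft ℂ ℂ Subtype.val ∘ₗ lam.row₂.extend j)) ∘ₗ
        (h j).toLinearMap ∘ₗ Fintype.linearCombination ℂ v
  have hΦ : Function.Injective Φ := by
    rw [injective_iff_map_eq_zero]
    intro z hz
    refine hy z ((h _).injective ?_)
    rw [CyclicRep.map_iter h hh, map_zero, CyclicRep.directSum_iter]
    have h₁ := congrArg Prod.fst hz
    have h₂ := congrArg Prod.snd hz
    refine Prod.ext (lam.row₁.iter_rep_eq_zero k j _ fun p hp => ?_)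
      (lam.row₂.iter_rep_eq_zero k j _ fun p hp => ?_)
    · exact congrFun h₁ ⟨p, hp⟩
    · exact congrFun h₂ ⟨p, hp⟩
  have := LinearMap.finrank_le_finrank_of_injective hΦ
  simp only [Module.finrank_prod, Module.finrank_fintype_fun_eq_card, Fintype.card_sum,
    Fintype.card_coe] at this
  exact this

/-! ### Length bounds forced by path ranks. -/

theorem TwoRow.finrank_eq_dimVec {n : ℕ} (lam : TwoRow n) (j : ZMod n) :
    Module.finrank ℂ ((lam.row₁.Box j → ℂ) × (lam.row₂.Box j → ℂ)) = lam.dimVec j := by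
  rw [Module.finrank_prod, Module.finrank_fintype_fun_eq_card,
    Module.finrank_fintype_fun_eq_card, TwoRow.dimVec, Nat.card_eq_fintype_card,
    Nat.card_eq_fintype_card]

theorem TwoRow.orbit_nonempty {n : ℕ} {V : ZMod n → Type*} [∀ i, AddCommGroup (V i)]
    [∀ i, Module ℂ (V i)] [∀ i, FiniteDimensional ℂ (V i)] {lam : TwoRow n}
    (h : ∀ j, lam.dimVec j = Module.finrank ℂ (V j)) : (lam.orbit V).Nonempty := by
  have h' (j : ZMod n) : Nonempty (V j ≃ₗ[ℂ] (lam.row₁.Box j → ℂ) × (lam.row₂.Box j → ℂ)) :=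
    FiniteDimensional.nonempty_linearEquiv_of_finrank_eq
      ((h j).symm.trans (lam.finrank_eq_dimVec j).symm)
  let g j := (h' j).some
  exact ⟨fun j => (g (j - 1)).symm.toLinearMap ∘ₗ
    CyclicRep.directSum lam.row₁.rep lam.row₂.rep j ∘ₗ (g j).toLinearMap, g, fun i v => by simp⟩

theorem TwoRow.le_of_leIn {n : ℕ} [NeZero n] {V : ZMod n → Type*} [∀ i, AddCommGroup (V i)]
    [∀ i, Module ℂ (V i)] [∀ i, FiniteDimensional ℂ (V i)] {i₁ i₂ : ZMod n} {l₁ l₂ m₁ m₂ : ℕ}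
    (hl : l₂ ≤ l₁) (h : TwoRow.LEIn V ⟨⟨i₁, m₁⟩, ⟨i₂, m₂⟩⟩ ⟨⟨i₁, l₁⟩, ⟨i₂, l₂⟩⟩) :
    m₁ ≤ l₁ ∧ m₂ ≤ l₁ := by
  obtain ⟨x, hx⟩ := TwoRow.orbit_nonempty h.1
  have key := TwoRow.boxCount_le_of_mem_zariskiClosure hx (h.2 hx) l₁
  simp only [boxCount_of_le _ _ le_rfl, boxCount_of_le _ _ hl, add_zero, Nat.le_zero,
    Nat.add_eq_zero_iff] at key
  constructor
  · by_contra! hm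
    have := boxCount_pos i₁ le_rfl hm
    have := (key (i₁ + l₁)).1
    omega
  · by_contra! hm
    have := boxCount_pos i₂ le_rfl hm
    have := (key (i₂ + l₁)).2
    omega

/-- Write `l₁ - m₁ = t * n` and let `d` be the residue of `i₂ - i₁`. If `m₁ < l₂ + d`, then among
boxes beyond `m₁` labelled `i₁ + m₁` the larger multisegment has only `t - 1`, while the second row
of the smaller one has at least `t`. -/
theorem TwoRow.lower_bound_of_leIn {n : ℕ} [NeZero n] {V : ZMod n → Type*}
    [∀ i, AddCommGroup (V i)] [∀ i, Module ℂ (V i)] [∀ i, FiniteDimensional ℂ (V i)]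
    {i₁ i₂ : ZMod n} {l₁ l₂ m₁ m₂ : ℕ} (hs : m₁ + m₂ = l₁ + l₂) (hm₁ : m₁ < l₁) (hm₂ : m₂ ≤ l₁)
    (hc : (m₁ : ZMod n) = l₁)
    (h : TwoRow.LEIn V ⟨⟨i₁, m₁⟩, ⟨i₂, m₂⟩⟩ ⟨⟨i₁, l₁⟩, ⟨i₂, l₂⟩⟩) :
    l₂ + (i₂ - i₁).val ≤ m₁ := by
  by_contra! hd
  have hdn := ZMod.val_lt (i₂ - i₁)
  have hdc : (((i₂ - i₁).val : ℕ) : ZMod n) = i₂ - i₁ := ZMod.natCast_zmod_val _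
  generalize (i₂ - i₁).val = d at hd hdn hdc
  obtain ⟨t, ht⟩ : n ∣ l₁ - m₁ := (ZMod.natCast_eq_zero_iff _ _).1 (by
    rw [Nat.cast_sub hm₁.le, hc, sub_self])
  rw [mul_comm] at ht
  have htn : n ≤ t * n := Nat.le_mul_of_pos_left n (Nat.pos_of_ne_zero fun h0 => by
    rw [h0, zero_mul] at ht; omega)
  obtain ⟨x, hx⟩ := TwoRow.orbit_nonempty h.1
  have key := TwoRow.boxCount_le_of_mem_zariskiClosure hx (h.2 hx) (m₁ + 1) (i₁ + m₁)
  simp only at key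
  rw [boxCount_of_le i₁ (i₁ + m₁) (Nat.le_succ m₁),
    boxCount_of_le i₂ (i₁ + m₁) (show l₂ ≤ m₁ + 1 by omega)] at key
  have hlam : 1 + boxCount i₁ (m₁ + 1) l₁ (i₁ + m₁) = t := by
    have h1 := boxCount_add i₁ (i₁ + m₁) (Nat.le_succ m₁) (Nat.succ_le_of_lt hm₁)
    have h2 := boxCount_succ i₁ (i₁ + m₁) m₁
    have h3 := boxCount_shift i₁ (i₁ + m₁) 0 (t * n) m₁
    rw [boxCount_mul_period, zero_add, ← ht, Nat.sub_add_cancel hm₁.le] at h3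
    rw [if_pos rfl] at h2
    simp only [Nat.succ_eq_add_one] at h1
    omega
  have hmu : t ≤ boxCount i₂ (m₁ + 1) m₂ (i₁ + m₁) := by
    have h1 := boxCount_shift i₂ (i₁ + m₁) 0 (t * n - d) (m₁ + 1)
    have h2 := boxCount_mono i₂ (i₁ + m₁) (m₁ + 1)
      (show t * n - d + (m₁ + 1) ≤ m₂ by omega)
    have h3 := boxCount_mul_period (i₂ + ((m₁ + 1 : ℕ) : ZMod n)) (i₁ + m₁) t
    have h4 := boxCount_add (i₂ + ((m₁ + 1 : ℕ) : ZMod n)) (i₁ + m₁) (Nat.zero_le (t * n - d))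
      (Nat.sub_le (t * n) d)
    -- These last `d < n` boxes begin at label `i₁ + m₁ + 1`, so they stop before returning to `i₁ +
    -- m₁`. Dropping them from `t` full periods loses nothing.
    have h5 : boxCount (i₂ + ((m₁ + 1 : ℕ) : ZMod n)) (t * n - d) (t * n) (i₁ + m₁) = 0 := by
      have h6 := boxCount_shift (i₂ + ((m₁ + 1 : ℕ) : ZMod n)) (i₁ + m₁) 0 d (t * n - d)
      have h7 : i₂ + ((m₁ + 1 : ℕ) : ZMod n) + ((t * n - d : ℕ) : ZMod n) = i₁ + m₁ + 1 := by
        rw [Nat.cast_sub (by omega), hdc]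
        push_cast
        rw [ZMod.natCast_self]
        ring
      rw [h7, boxCount_eq_zero _ hdn, zero_add, show d + (t * n - d) = t * n by omega] at h6
      exact h6
    rw [zero_add] at h1
    omega
  omega

/-! ### Zariski closure along lines. -/

theorem polyFunctions_line {E : Type*} [AddCommGroup E] [Module ℂ E] {f : E → ℂ}
    (hf : f ∈ polyFunctions E) (x y : E) :
    ∃ p : Polynomial ℂ, ∀ s : ℂ, p.eval s = f (x + s • y) := by
  induction hf using Algebra.adjoin_induction with
  | mem f hf =>
    obtain ⟨φ, rfl⟩ := hf
    exact ⟨Polynomial.C (φ x) + Polynomial.X * Polynomial.C (φ y), fun s => by simp [mul_comm s]⟩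
  | algebraMap c => exact ⟨Polynomial.C c, fun s => by simp⟩
  | add f g _ _ hf hg =>
    obtain ⟨p, hp⟩ := hf
    obtain ⟨q, hq⟩ := hg
    exact ⟨p + q, fun s => by simp [hp, hq]⟩
  | mul f g _ _ hf hg =>
    obtain ⟨p, hp⟩ := hf
    obtain ⟨q, hq⟩ := hg
    exact ⟨p * q, fun s => by simp [hp, hq]⟩

theorem mem_zariskiClosure_of_line {E : Type*} [AddCommGroup E] [Module ℂ E] {S : Set E}
    (x y : E) (h : ∀ s : ℂ, s ≠ 0 → x + s • y ∈ S) : x ∈ zariskiClosure S := by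
  intro f hf hS
  obtain ⟨p, hp⟩ := polyFunctions_line hf x y
  have h0 : p = 0 := p.eq_zero_of_infinite_isRoot <|
    (Set.finite_singleton (0 : ℂ)).infinite_compl.mono fun s hs => (hp s).trans (hS _ (h s hs))
  simpa [h0] using (hp 0).symm

theorem subset_zariskiClosure {E : Type*} [AddCommGroup E] [Module ℂ E] (S : Set E) :
    S ⊆ zariskiClosure S :=
  fun x hx _ _ hf => hf x hx

theorem subset_zariskiClosure_trans {E : Type*} [AddCommGroup E] [Module ℂ E] {S T U : Set E}
    (h₁ : S ⊆ zariskiClosure T) (h₂ : T ⊆ zariskiClosure U) : S ⊆ zariskiClosure U :=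
  fun _ hx f hf hU => h₁ hx f hf fun _ hy => h₂ hy f hf hU

/-! ### The exchange degeneration. -/

section Exchange

variable {n : ℕ} (i₁ i₂ : ZMod n) (e l m : ℕ)

/-- The isomorphism onto the deformed representation, in coordinates
`(a, b) ↦ (s a_p, a_{r + e} + b_r)`. -/
def exchangeMap (s : ℂ) (j : ZMod n) :
    (((⟨i₁, m + e⟩ : Segment n).Box j → ℂ) × ((⟨i₂, l⟩ : Segment n).Box j → ℂ)) →ₗ[ℂ]
      (((⟨i₁, l + e⟩ : Segment n).Box j → ℂ) × ((⟨i₂, m⟩ : Segment n).Box j → ℂ)) :=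
  LinearMap.prod
    (s • ((⟨i₁, l + e⟩ : Segment n).restrict j ∘ₗ (⟨i₁, m + e⟩ : Segment n).extend j ∘ₗ
      LinearMap.fst ℂ _ _))
    ((⟨i₂, m⟩ : Segment n).restrict j ∘ₗ
      (LinearMap.funLeft ℂ ℂ (fun r : ℕ => r + e) ∘ₗ (⟨i₁, m + e⟩ : Segment n).extend j ∘ₗ
          LinearMap.fst ℂ _ _ +
        (⟨i₂, l⟩ : Segment n).extend j ∘ₗ LinearMap.snd ℂ _ _))

/-- The direction of deformation, in coordinates `(u, v) ↦ (v_l δ_{l + e - 1}, 0)`. -/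
def exchangeDirection (j : ZMod n) :
    (((⟨i₁, l + e⟩ : Segment n).Box j → ℂ) × ((⟨i₂, m⟩ : Segment n).Box j → ℂ)) →ₗ[ℂ]
      (((⟨i₁, l + e⟩ : Segment n).Box (j - 1) → ℂ) ×
        ((⟨i₂, m⟩ : Segment n).Box (j - 1) → ℂ)) :=
  LinearMap.inl ℂ _ _ ∘ₗ (⟨i₁, l + e⟩ : Segment n).restrict (j - 1) ∘ₗ
    LinearMap.pi (fun p : ℕ => if p + 1 = l + e then LinearMap.proj l else 0) ∘ₗ
      (⟨i₂, m⟩ : Segment n).extend j ∘ₗ LinearMap.snd ℂ _ _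

variable {i₁ i₂ e l m}

theorem exchangeMap_fst (s : ℂ) (j : ZMod n)
    (w : ((⟨i₁, m + e⟩ : Segment n).Box j → ℂ) × ((⟨i₂, l⟩ : Segment n).Box j → ℂ))
    (p : (⟨i₁, l + e⟩ : Segment n).Box j) :
    (exchangeMap i₁ i₂ e l m s j w).1 p =
      s * (⟨i₁, m + e⟩ : Segment n).extend j w.1 p.1 := rfl

theorem exchangeMap_snd (s : ℂ) (j : ZMod n)
    (w : ((⟨i₁, m + e⟩ : Segment n).Box j → ℂ) × ((⟨i₂, l⟩ : Segment n).Box j → ℂ))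
    (r : (⟨i₂, m⟩ : Segment n).Box j) :
    (exchangeMap i₁ i₂ e l m s j w).2 r =
      (⟨i₁, m + e⟩ : Segment n).extend j w.1 (r.1 + e) +
        (⟨i₂, l⟩ : Segment n).extend j w.2 r.1 := rfl

theorem extend_exchangeMap_fst (s : ℂ) (j : ZMod n)
    (w : ((⟨i₁, m + e⟩ : Segment n).Box j → ℂ) × ((⟨i₂, l⟩ : Segment n).Box j → ℂ)) (p : ℕ) :
    (⟨i₁, l + e⟩ : Segment n).extend j (exchangeMap i₁ i₂ e l m s j w).1 p =
      if p < l + e then s * (⟨i₁, m + e⟩ : Segment n).extend j w.1 p else 0 := by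
  by_cases h : p < l + e ∧ i₁ + (p : ZMod n) = j
  · rw [if_pos h.1]
    exact (Segment.extend_apply_box (⟨i₁, l + e⟩ : Segment n) j _ ⟨⟨p, h.1⟩, h.2⟩).trans
      (exchangeMap_fst s j w _)
  · rw [Segment.extend_eq_zero _ j _ h]
    split_ifs with hp
    · rw [Segment.extend_eq_zero _ j _ fun h' => h ⟨hp, h'.2⟩, mul_zero]
    · rfl

/-- No truncation is needed, unlike in the first component: `m + e` and `l ≤ m` keep both terms
inside the row, and `e ≡ i₂ - i₁` matches their labels. -/
theorem extend_exchangeMap_snd (he : (e : ZMod n) = i₂ - i₁) (hlm : l ≤ m) (s : ℂ) (j : ZMod n)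
    (w : ((⟨i₁, m + e⟩ : Segment n).Box j → ℂ) × ((⟨i₂, l⟩ : Segment n).Box j → ℂ)) (r : ℕ) :
    (⟨i₂, m⟩ : Segment n).extend j (exchangeMap i₁ i₂ e l m s j w).2 r =
      (⟨i₁, m + e⟩ : Segment n).extend j w.1 (r + e) +
        (⟨i₂, l⟩ : Segment n).extend j w.2 r := by
  by_cases h : r < m ∧ i₂ + (r : ZMod n) = j
  · exact (Segment.extend_apply_box (⟨i₂, m⟩ : Segment n) j _ ⟨⟨r, h.1⟩, h.2⟩).trans
      (exchangeMap_snd s j w _)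
  · rw [Segment.extend_eq_zero _ j _ h, Segment.extend_eq_zero _ j, Segment.extend_eq_zero _ j,
      add_zero]
    · exact fun h' => h ⟨lt_of_lt_of_le h'.1 hlm, h'.2⟩
    · rintro ⟨h₁, h₂⟩
      refine h ⟨Nat.lt_of_add_lt_add_right h₁, ?_⟩
      push_cast at h₂
      rw [he] at h₂
      linear_combination h₂

/-- The first component determines `a` below `l + e`. From there on the second component is `a`
alone, because `b` vanishes from `l` on. -/
theorem exchangeMap_injective (he : (e : ZMod n) = i₂ - i₁) (hlm : l ≤ m) {s : ℂ} (hs : s ≠ 0)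
    (j : ZMod n) : Function.Injective (exchangeMap i₁ i₂ e l m s j) := by
  rw [injective_iff_map_eq_zero]
  intro w hw
  have h₁ (p : ℕ) (hp : p < l + e) : (⟨i₁, m + e⟩ : Segment n).extend j w.1 p = 0 := by
    have := extend_exchangeMap_fst s j w p
    rw [hw, if_pos hp, Prod.fst_zero, map_zero] at this
    exact (mul_eq_zero.1 this.symm).resolve_left hs
  have h₂ (r : ℕ) : (⟨i₁, m + e⟩ : Segment n).extend j w.1 (r + e) +
      (⟨i₂, l⟩ : Segment n).extend j w.2 r = 0 := by
    have := extend_exchangeMap_snd he hlm s j w r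
    rw [hw, Prod.snd_zero, map_zero] at this
    exact this.symm
  have h₃ (p : ℕ) : (⟨i₁, m + e⟩ : Segment n).extend j w.1 p = 0 := by
    by_cases hp : p < l + e
    · exact h₁ p hp
    · have := h₂ (p - e)
      rwa [Nat.sub_add_cancel (by omega), Segment.extend_eq_zero_of_le (⟨i₂, l⟩ : Segment n) j w.2
        (show l ≤ p - e by omega), add_zero] at this
  refine Prod.ext ?_ ?_
  · apply Segment.extend_injective
    rw [Prod.fst_zero, map_zero]
    exact funext h₃
  · apply Segment.extend_injective
    rw [Prod.snd_zero, map_zero]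
    funext r
    simpa [h₃] using h₂ r

theorem exchangeMap_intertwines (he : (e : ZMod n) = i₂ - i₁) (hlm : l ≤ m) (s : ℂ) (j : ZMod n)
    (w : ((⟨i₁, m + e⟩ : Segment n).Box j → ℂ) × ((⟨i₂, l⟩ : Segment n).Box j → ℂ)) :
    exchangeMap i₁ i₂ e l m s (j - 1)
        (CyclicRep.directSum (⟨i₁, m + e⟩ : Segment n).rep (⟨i₂, l⟩ : Segment n).rep j w) =
      CyclicRep.directSum (⟨i₁, l + e⟩ : Segment n).rep (⟨i₂, m⟩ : Segment n).rep j
          (exchangeMap i₁ i₂ e l m s j w) +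
        s • exchangeDirection i₁ i₂ e l m j (exchangeMap i₁ i₂ e l m s j w) := by
  refine Prod.ext (funext fun p => ?_) (funext fun r => ?_)
  · have hp : (p.1 : ℕ) < l + e := p.1.2
    have h : (exchangeDirection i₁ i₂ e l m j (exchangeMap i₁ i₂ e l m s j w)).1 p =
        if (p.1 : ℕ) + 1 = l + e then
          (⟨i₂, m⟩ : Segment n).extend j (exchangeMap i₁ i₂ e l m s j w).2 l else 0 := by
      simp only [exchangeDirection, LinearMap.comp_apply, LinearMap.inl_apply,
        Segment.restrict_apply, LinearMap.pi_apply, LinearMap.snd_apply]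
      split_ifs <;> rfl
    rw [exchangeMap_fst, Prod.fst_add, Prod.smul_fst, Pi.add_apply, Pi.smul_apply, h, smul_eq_mul]
    simp only [CyclicRep.directSum, LinearMap.prodMap_apply]
    rw [Segment.extend_rep, Segment.rep_apply, extend_exchangeMap_fst,
      extend_exchangeMap_snd he hlm]
    rw [Segment.extend_eq_zero_of_le (⟨i₂, l⟩ : Segment n) j w.2 (le_refl l), add_zero]
    -- At the last box of the first row the undeformed arrow gives zero, and the deformation
    -- supplies the missing `s * a_{l + e}`.
    by_cases hpl : (p.1 : ℕ) + 1 = l + e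
    · rw [if_neg (by omega), if_pos hpl, hpl, zero_add]
    · rw [if_pos (by omega), if_neg hpl, mul_zero, add_zero]
  · rw [exchangeMap_snd, Prod.snd_add, Prod.smul_snd, Pi.add_apply, Pi.smul_apply]
    simp only [CyclicRep.directSum, LinearMap.prodMap_apply]
    rw [Segment.extend_rep, Segment.extend_rep, Segment.rep_apply, extend_exchangeMap_snd he hlm]
    simp [exchangeDirection, add_right_comm]

end Exchange

/-- Exchanging the parts of two overlapping rows above the overlap is a degeneration. -/
theorem TwoRow.orbit_subset_zariskiClosure_exchange {n : ℕ} (V : ZMod n → Type*)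
    [∀ i, AddCommGroup (V i)] [∀ i, Module ℂ (V i)] {i₁ i₂ : ZMod n} {e l m : ℕ}
    (he : (e : ZMod n) = i₂ - i₁) (hlm : l ≤ m) :
    (TwoRow.mk ⟨i₁, l + e⟩ ⟨i₂, m⟩).orbit V ⊆
      zariskiClosure ((TwoRow.mk ⟨i₁, m + e⟩ ⟨i₂, l⟩).orbit V) := by
  rintro x ⟨g, hg⟩
  refine mem_zariskiClosure_of_line x (fun j => (g (j - 1)).symm.toLinearMap ∘ₗ
    exchangeDirection i₁ i₂ e l m j ∘ₗ (g j).toLinearMap) fun s hs => ?_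
  let φ := fun j => LinearEquiv.ofInjectiveOfFinrankEq (exchangeMap i₁ i₂ e l m s j)
    (exchangeMap_injective he hlm hs j)
    (((TwoRow.mk ⟨i₁, m + e⟩ ⟨i₂, l⟩).finrank_eq_dimVec j).trans
      ((TwoRow.dimVec_exchange i₁ i₂ e l m he j).symm.trans
        ((TwoRow.mk ⟨i₁, l + e⟩ ⟨i₂, m⟩).finrank_eq_dimVec j).symm))
  refine ⟨fun j => (g j).trans (φ j).symm, fun j v => ?_⟩
  rw [LinearEquiv.trans_apply, LinearEquiv.symm_apply_eq]
  obtain ⟨w, hw⟩ := (φ j).surjective (g j v)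
  rw [LinearEquiv.trans_apply, ← hw, LinearEquiv.symm_apply_apply]
  refine Eq.trans ?_ (exchangeMap_intertwines he hlm s j w).symm
  have hw' : exchangeMap i₁ i₂ e l m s j w = g j v := hw
  rw [hw', ← hg]
  simp

/-! ### Assembling the criterion. -/

theorem TwoRow.leIn_of_conditions {n : ℕ} [NeZero n] (V : ZMod n → Type*)
    [∀ i, AddCommGroup (V i)] [∀ i, Module ℂ (V i)] {i₁ i₂ : ZMod n} {l₁ l₂ m₁ m₂ : ℕ}
    (hV : ∀ j, (TwoRow.mk ⟨i₁, l₁⟩ ⟨i₂, l₂⟩).dimVec j = Module.finrank ℂ (V j))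
    (hm : l₂ ≤ m₁) (hm' : l₂ ≤ m₂) (hs : m₁ + m₂ = l₁ + l₂)
    (hc : (m₁ : ZMod n) = i₂ - i₁ + l₂) :
    TwoRow.LEIn V ⟨⟨i₁, m₁⟩, ⟨i₂, m₂⟩⟩ ⟨⟨i₁, l₁⟩, ⟨i₂, l₂⟩⟩ := by
  obtain ⟨e, rfl⟩ := Nat.exists_eq_add_of_le hm
  obtain rfl : l₁ = m₂ + e := by omega
  have he : (e : ZMod n) = i₂ - i₁ := by
    push_cast at hc
    linear_combination hc
  exact ⟨fun j => (TwoRow.dimVec_exchange i₁ i₂ e l₂ m₂ he j).trans (hV j),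
    TwoRow.orbit_subset_zariskiClosure_exchange V he hm'⟩

theorem TwoRow.LEIn.refl {n : ℕ} {V : ZMod n → Type*} [∀ i, AddCommGroup (V i)]
    [∀ i, Module ℂ (V i)] {lam : TwoRow n}
    (hV : ∀ j, lam.dimVec j = Module.finrank ℂ (V j)) : TwoRow.LEIn V lam lam :=
  ⟨hV, subset_zariskiClosure _⟩

theorem TwoRow.LEIn.trans {n : ℕ} {V : ZMod n → Type*} [∀ i, AddCommGroup (V i)]
    [∀ i, Module ℂ (V i)] {mu nu lam : TwoRow n} (h₁ : TwoRow.LEIn V mu nu)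
    (h₂ : TwoRow.LEIn V nu lam) : TwoRow.LEIn V mu lam :=
  ⟨h₁.1, subset_zariskiClosure_trans h₁.2 h₂.2⟩

theorem corollary5p5 {n : ℕ} [NeZero n] (V : ZMod n → Type*) [∀ i, AddCommGroup (V i)]
    [∀ i, Module ℂ (V i)] [∀ i, FiniteDimensional ℂ (V i)]
    (i₁ i₂ : ZMod n) (l₁ l₂ m₁ m₂ : ℕ) (hl : l₂ ≤ l₁)
    (hV : ∀ j, (TwoRow.mk ⟨i₁, l₁⟩ ⟨i₂, l₂⟩).dimVec j = Module.finrank ℂ (V j)) :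
    TwoRow.LEIn V ⟨⟨i₁, m₁⟩, ⟨i₂, m₂⟩⟩ ⟨⟨i₁, l₁⟩, ⟨i₂, l₂⟩⟩ ↔
      (m₁ = l₁ ∧ m₂ = l₂) ∨
      (m₁ + m₂ = l₁ + l₂ ∧ m₁ ≤ l₁ ∧ l₂ + (i₂ - i₁).val ≤ m₁ ∧
        (((m₁ : ZMod n) = (l₁ : ZMod n) ∧ (m₂ : ZMod n) = (l₂ : ZMod n)) ∨
         ((m₁ : ZMod n) = i₂ - i₁ + (l₂ : ZMod n) ∧
          (m₂ : ZMod n) = i₁ - i₂ + (l₁ : ZMod n)))) := by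
  have hdc : (((i₂ - i₁).val : ℕ) : ZMod n) = i₂ - i₁ := ZMod.natCast_zmod_val _
  have hdn := ZMod.val_lt (i₂ - i₁)
  constructor
  · intro h
    have hd (j : ZMod n) := (h.1 j).trans (hV j).symm
    have hs := TwoRow.length_add_of_dimVec_eq hd
    have hc := TwoRow.length_congr_of_dimVec_eq hd
    obtain ⟨hm₁, hm₂⟩ := TwoRow.le_of_leIn hl h
    rcases hm₁.eq_or_lt with rfl | hm₁'
    · exact Or.inl ⟨rfl, by omega⟩
    refine Or.inr ⟨hs, hm₁, ?_, hc⟩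
    rcases hc with hc | hc
    · exact TwoRow.lower_bound_of_leIn hs hm₁' hm₂ hc.1 h
    -- `m₂ ≤ l₁` gives `l₂ ≤ m₁`, and a natural number is at least its residue modulo `n`.
    · have h1 : ((m₁ - l₂ : ℕ) : ZMod n) = i₂ - i₁ := by
        rw [Nat.cast_sub (by omega), hc.1, add_sub_cancel_right]
      have h2 := Nat.mod_le (m₁ - l₂) n
      rw [← ZMod.val_natCast, h1] at h2
      omega
  · rintro (⟨rfl, rfl⟩ | ⟨hs, hm₁, hd, ⟨hc₁, hc₂⟩ | ⟨hc, -⟩⟩)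
    · exact TwoRow.LEIn.refl hV
    · rcases Nat.eq_zero_or_pos (m₂ - l₂) with h0 | h0
      · obtain rfl : m₂ = l₂ := by omega
        obtain rfl : m₁ = l₁ := by omega
        exact TwoRow.LEIn.refl hV
      · have hn : n ≤ m₂ - l₂ := Nat.le_of_dvd h0 ((ZMod.natCast_eq_zero_iff _ _).1 (by
          rw [Nat.cast_sub (by omega), hc₂, sub_self]))
        -- The intermediate lengths are `(l₁ - r, l₂ + r)`, with `r` the least solution of the
        -- congruence that the exchanges require. As `r < n ≤ m₂ - l₂`, both exchanges satisfy the
        -- length conditions.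
        have hr := Nat.mod_lt (m₁ - (i₂ - i₁).val - l₂) (NeZero.pos n)
        have hr' := Nat.mod_le (m₁ - (i₂ - i₁).val - l₂) n
        have hrc : (((m₁ - (i₂ - i₁).val - l₂) % n : ℕ) : ZMod n) = m₁ - (i₂ - i₁) - l₂ := by
          rw [ZMod.natCast_mod, Nat.cast_sub (by omega), Nat.cast_sub (by omega), hdc]
        generalize (m₁ - (i₂ - i₁).val - l₂) % n = r at hr hr' hrc
        have h₁ : TwoRow.LEIn V ⟨⟨i₁, l₁ - r⟩, ⟨i₂, l₂ + r⟩⟩ ⟨⟨i₁, l₁⟩, ⟨i₂, l₂⟩⟩ :=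
          TwoRow.leIn_of_conditions V hV (by omega) (by omega) (by omega) (by
            rw [Nat.cast_sub (by omega), hrc, hc₁]
            ring)
        refine TwoRow.LEIn.trans (TwoRow.leIn_of_conditions V h₁.1 ?_ ?_ ?_ ?_) h₁
        · omega
        · omega
        · omega
        · push_cast
          rw [hrc]
          ring
    · exact TwoRow.leIn_of_conditions V hV (by omega) (by omega) hs hc
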